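/- For $n\in\mathbb N$ let $\Delta^n=\{\mathbf x\in\mathbb R^n: 0\le x_1\le x_2\le\dots\le x_n\le 1\}$, put $x_0=0$, $x_{n+1}=1$, and for $\mathbf x\in\Delta^n$ let $\Sigma_n(\mathbf x):[0,1]\to\{1,-1\}$ be the switch function with $\Sigma_n(\mathbf x)(t)=(-1)^m$ for $x_m\le t<x_{m+1}$ $(0\le m\le n)$ and $\Sigma_n(\mathbf x)(1)=(-1)^n$. Write $\langle f,\sigma\rangle=\int_0^1\sigma(t)f(t)\,dt$. For $m\ge 0$ and real $\theta$ define $$P_m(x,\theta)=\sum_{i=0}^m(-1)^i\frac{m!\,(2m-i)!}{(2m)!\,(m-i)!}\binom{m+\theta}{i}x^{m-i},$$ $$Q_{m+1}(x,\theta)=\sum_{i=0}^{m+1}(-1)^i\frac{(m+1)!\,(2m+1-i)!}{(2m+1)!\,(m+1-i)!}\binom{m+\theta}{i}x^{m+1-i},$$ $$R_m(x,\theta)=\sum_{i=0}^m(-1)^i\frac{m!\,(2m+1-i)!}{(2m+1)!\,(m-i)!}\binom{m+1+\theta}{i}x^{m-i},$$ where $\binom{a}{i}=a(a-1)\cdots(a-i+1)/i!$.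 Theorem. Let $\lambda\in(-1,1)$, $n\in\mathbb N$ and $\mathbf x\in\Delta^n$. Then $$\langle p,\Sigma_n(\mathbf x)-\lambda\rangle=0\quad\text{for every real polynomial }p\text{ of degree}\le n-1$$ if and only if $x_1,\dots,x_n$ are, in increasing order and counted with multiplicity, all the real roots of the following two polynomials taken together: - $P_m(x,\theta)$ and $P_m(x,-\theta)$ with $\theta=\frac{1-\lambda}{2}$, if $n=2m$; - $Q_{m+1}(x,\theta)$ and $R_m(x,-\theta)$ with $\theta=\frac{1+\lambda}{2}$, if $n=2m+1$. In this case the roots are simple and interleave: $0<x_1<x_2<\dots<x_n<1$, the roots of the first polynomial are $x_n,x_{n-2},x_{n-4},\dots$ and the roots of the second are $x_{n-1},x_{n-3},\dots$. (Thus the roots of the first polynomial are $x_1,x_3,\dots$ if $n$ is odd, and $x_2,x_4,\dots$ if $n$ is even.) Moreover, for every $\lambda\in(-1,1)$ and $n\in\mathbb N$ such an $\mathbf x\in\Delta^n$ exists. -/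

import Mathlib

open Polynomial Finset

noncomputable section

namespace SwitchFun

/-- The standard `n`-simplex `0 ≤ x₁ ≤ x₂ ≤ … ≤ xₙ ≤ 1` in `ℝⁿ`;
the coordinate `xᵢ` is `x ⟨i - 1, _⟩`. -/
def simplex (n : ℕ) : Set (Fin n → ℝ) :=
  {x | Monotone x ∧ ∀ i, x i ∈ Set.Icc (0 : ℝ) 1}

/-- The switch function `Σₙ(x)`: its value at `t` is `(-1)^m`, where `m` is the number of
switch points `xᵢ ≤ t`. -/
def switch {n : ℕ} (x : Fin n → ℝ) (t : ℝ) : ℝ :=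
  (-1) ^ #{i : Fin n | x i ≤ t}

/-- `Σₙ(x)(t) = (-1)^m` whenever `x_m ≤ t < x_{m+1}`: for `x` in the simplex, this says that
`x₁, …, x_m` are at most `t` and `x_{m+1}, …, xₙ` exceed `t`. -/
theorem switch_eq {n : ℕ} {x : Fin n → ℝ} {t : ℝ} {m : ℕ} (hm : m ≤ n)
    (h₁ : ∀ i : Fin n, (i : ℕ) < m → x i ≤ t) (h₂ : ∀ i : Fin n, m ≤ (i : ℕ) → t < x i) :
    switch x t = (-1) ^ m := by
  have h : (Finset.univ.filter fun i : Fin n => x i ≤ t)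
      = Finset.univ.filter fun i : Fin n => (i : ℕ) < m := by
    ext i
    simp only [Finset.mem_filter, Finset.mem_univ, true_and]
    refine ⟨fun hi => ?_, h₁ i⟩
    by_contra hc
    exact absurd hi (not_le.mpr (h₂ i (not_lt.mp hc)))
  have hc : (Finset.univ.filter fun i : Fin n => (i : ℕ) < m).card = m := by
    rw [Fin.card_filter_val_lt, min_eq_right hm]
  rw [switch, h, hc]

/-- `Σₙ(x)(1) = (-1)^n`. -/
theorem switch_one {n : ℕ} {x : Fin n → ℝ} (hx : x ∈ simplex n) :
    switch x 1 = (-1) ^ n :=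
  switch_eq le_rfl (fun i _ => (hx.2 i).2) fun i hi => absurd i.2 (not_lt.mpr hi)

/-- The pairing `⟨f, σ⟩ = ∫₀¹ σ(t) f(t) dt`. -/
def pairing (f σ : ℝ → ℝ) : ℝ := ∫ t in (0 : ℝ)..1, σ t * f t

/-- `⟨p, Σₙ(x) - l⟩ = 0` for every real polynomial `p` of degree at most `n - 1`. -/
def Orthogonal {n : ℕ} (x : Fin n → ℝ) (l : ℝ) : Prop :=
  ∀ p : ℝ[X], p.degree < (n : WithBot ℕ) →
    pairing (fun t => p.eval t) (fun t => switch x t - l) = 0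

/-- The polynomial `P_m(x, θ)`. Here and below `Ring.choose a i` is the generalized binomial
coefficient `a (a - 1) ⋯ (a - i + 1) / i!`. -/
def P (m : ℕ) (θ : ℝ) : ℝ[X] :=
  ∑ i ∈ range (m + 1),
    C ((-1) ^ i * (((m.factorial : ℝ) * ((2 * m - i).factorial : ℝ)) /
        (((2 * m).factorial : ℝ) * ((m - i).factorial : ℝ))) *
      Ring.choose ((m : ℝ) + θ) i) * X ^ (m - i)

/-- `QSucc m θ` is the polynomial `Q_{m+1}(x, θ)`, of degree `m + 1`. -/
def QSucc (m : ℕ) (θ : ℝ) : ℝ[X] :=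
  ∑ i ∈ range (m + 2),
    C ((-1) ^ i * ((((m + 1).factorial : ℝ) * ((2 * m + 1 - i).factorial : ℝ)) /
        (((2 * m + 1).factorial : ℝ) * ((m + 1 - i).factorial : ℝ))) *
      Ring.choose ((m : ℝ) + θ) i) * X ^ (m + 1 - i)

/-- The polynomial `R_m(x, θ)`. -/
def R (m : ℕ) (θ : ℝ) : ℝ[X] :=
  ∑ i ∈ range (m + 1),
    C ((-1) ^ i * (((m.factorial : ℝ) * ((2 * m + 1 - i).factorial : ℝ)) /
        (((2 * m + 1).factorial : ℝ) * ((m - i).factorial : ℝ))) *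
      Ring.choose ((m : ℝ) + 1 + θ) i) * X ^ (m - i)

/-- `x₁ ≤ … ≤ xₙ` is the list, in increasing order, of the real roots of `A` together with those
of `B`, counted with multiplicity. -/
def AreRootsInOrder {n : ℕ} (x : Fin n → ℝ) (A B : ℝ[X]) : Prop :=
  Monotone x ∧ (Finset.univ : Finset (Fin n)).val.map x = A.roots + B.roots

/-- `0 < x₁ < ⋯ < xₙ < 1`, the roots of `A` are `xₙ, xₙ₋₂, …` and those of `B` are
`xₙ₋₁, xₙ₋₃, …`, all roots being simple (`x i` is the coordinate of number `i + 1`). -/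
def AreInterleavedRoots {n : ℕ} (x : Fin n → ℝ) (A B : ℝ[X]) : Prop :=
  StrictMono x ∧ (∀ i, x i ∈ Set.Ioo (0 : ℝ) 1) ∧
    A.roots = (Finset.univ.filter fun i : Fin n => ((i : ℕ) + 1) % 2 = n % 2).val.map x ∧
    B.roots = (Finset.univ.filter fun i : Fin n => ((i : ℕ) + 1) % 2 ≠ n % 2).val.map x

end SwitchFun

end

/-!
The proof turns orthogonality into a quadrature formula. Put `δ = n % 2` and
`θ = (1 - (-1) ^ n * l) / 2`, which lies in `(0, 1)`. Applying orthogonality to `q'` shows that it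
means `∑ ±q(xᵢ) = θ q(1) + (δ - θ) q(0)` for all `q` of degree at most `n`, where the signs alternate
and `xₙ` has the sign `+` (`orthogonal_iff_signedQuadrature`). For `q = X ^ j` this prescribes the
signed power sums of `x`, and Newton's identities show that there is at most one increasing solution,
provided one with distinct entries is known (`eq_of_signed_sum_pow_eq`). It remains to show that the
zeros of the two given polynomials `A` and `B` interlace and form a solution.

Both polynomials are monic Jacobi polynomials on `[0, 1]` with weight exponents greater than `-1`.
The derivative of a Jacobi polynomial is again one, so the differential equation and the
intermediate value theorem give, by induction on the degree, that all zeros are simple and lie in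
`(0, 1)` (`jacobi_eq_nodal`). Moreover `A` and a weight times `B` solve the same hypergeometric
equation, and constancy of their normalized Wronskian reads
`x (x - 1) (A' B - A B') - (δ (x - 1) + θ) A B = K` (`jacobi_wronskian`). Setting `x = 1` gives
`K = -θ A(1) B(1) < 0`. Hence `x (x - 1) (A B)'` equals `K` at the zeros of `A` and `-K` at those of
`B`. Since the sign of `(A B)'` alternates along the zeros of `A B`, they interlace, the largest one
belonging to `A`. The same values say that the weights `±1` are `K` times the Lagrange weights of
the nodes `0, x₁, …, xₙ, 1`, and the vanishing of the divided differences of `q` over these `n + 2`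
nodes is the quadrature formula (`exists_interleaved_quadrature`).
-/

namespace SwitchFun

/-! ### Monic Jacobi polynomials on `[0, 1]` -/

/-- The monic Jacobi polynomial of degree `d` for the weight `x ^ (a - 1) * (1 - x) ^ (b - 1)` on
`[0, 1]`, given by its coefficients. -/
noncomputable def jacobi (d : ℕ) (a b : ℝ) : ℝ[X] :=
  ∑ k ∈ range (d + 1), C ((-1) ^ (d - k) * (d.choose k : ℝ) *
    ∏ j ∈ range (d - k), (a + d - 1 - j) / (a + b + 2 * d - 2 - j)) * X ^ k

theorem coeff_jacobi (d : ℕ) (a b : ℝ) (k : ℕ) :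
    (jacobi d a b).coeff k = (-1) ^ (d - k) * (d.choose k : ℝ) *
      ∏ j ∈ range (d - k), (a + d - 1 - j) / (a + b + 2 * d - 2 - j) := by
  simp only [jacobi, finsetSum_coeff, coeff_C_mul_X_pow]
  rw [Finset.sum_ite_eq]
  split_ifs with h
  · rfl
  · rw [Nat.choose_eq_zero_of_lt (by simpa using h)]
    simp

theorem natDegree_jacobi (d : ℕ) (a b : ℝ) : (jacobi d a b).natDegree = d := by
  apply le_antisymm
  · rw [natDegree_le_iff_coeff_eq_zero]
    intro k hk
    rw [coeff_jacobi, Nat.choose_eq_zero_of_lt hk]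
    simp
  · apply le_natDegree_of_ne_zero
    simp [coeff_jacobi]

theorem monic_jacobi (d : ℕ) (a b : ℝ) : (jacobi d a b).Monic := by
  rw [Monic, leadingCoeff, natDegree_jacobi, coeff_jacobi]
  simp

theorem derivative_jacobi (d : ℕ) (a b : ℝ) :
    derivative (jacobi (d + 1) a b) = C ((d : ℝ) + 1) * jacobi d (a + 1) (b + 1) := by
  ext k
  rw [coeff_derivative, coeff_C_mul, coeff_jacobi, coeff_jacobi, Nat.add_sub_add_right]
  have h : ((d + 1 : ℕ) : ℝ) * (d.choose k : ℝ) = ((d + 1).choose (k + 1) : ℝ) * ((k + 1 : ℕ) : ℝ) :=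
    mod_cast Nat.add_one_mul_choose_eq d k
  push_cast at h
  have h2 : ∀ j : ℕ, (a + 1 + d - 1 - j) / (a + 1 + (b + 1) + 2 * d - 2 - j)
      = (a + ((d + 1 : ℕ) : ℝ) - 1 - j) / (a + b + 2 * ((d + 1 : ℕ) : ℝ) - 2 - j) := by
    intro j
    push_cast
    congr 1 <;> ring
  simp only [h2]
  linear_combination (-(-1) ^ (d - k) *
    ∏ j ∈ range (d - k), (a + ((d + 1 : ℕ) : ℝ) - 1 - j) /
      (a + b + 2 * ((d + 1 : ℕ) : ℝ) - 2 - j)) * h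

theorem coeff_X_mul_derivative (p : ℝ[X]) (k : ℕ) :
    (X * derivative p).coeff k = k * p.coeff k := by
  cases k with
  | zero => simp
  | succ k =>
    rw [coeff_X_mul, coeff_derivative]
    push_cast
    ring

/-- The two-term recurrence of the coefficients, equivalent to the differential equation. -/
theorem coeff_jacobi_recurrence (d : ℕ) {a b : ℝ} (hab : 0 < a + b) (k : ℕ) :
    (d - k) * (k + d + a + b - 1) * (jacobi d a b).coeff k
      = -((k + 1) * (k + a) * (jacobi d a b).coeff (k + 1)) := by
  rcases lt_or_ge k d with h | h
  · obtain ⟨e, rfl⟩ : ∃ e, d = k + 1 + e := ⟨d - (k + 1), by omega⟩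
    rw [coeff_jacobi, coeff_jacobi, show k + 1 + e - k = e + 1 by omega,
      show k + 1 + e - (k + 1) = e by omega, prod_range_succ, pow_succ]
    have hc : ((k + 1 + e).choose (k + 1) : ℝ) * (k + 1) = ((k + 1 + e).choose k : ℝ) * (e + 1) := by
      have := Nat.choose_succ_right_eq (k + 1 + e) k
      rw [show k + 1 + e - k = e + 1 by omega] at this
      exact_mod_cast this
    have hk : (0 : ℝ) ≤ k := k.cast_nonneg
    have he : (0 : ℝ) ≤ e := e.cast_nonneg
    generalize ∏ j ∈ range e, (a + ((k + 1 + e : ℕ) : ℝ) - 1 - j) /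
      (a + b + 2 * ((k + 1 + e : ℕ) : ℝ) - 2 - j) = Z
    push_cast
    have hne : a + b + 2 * ((k : ℝ) + 1 + e) - 2 - e ≠ 0 := by
      intro h0
      linarith
    have hD : (k : ℝ) + (k + 1 + e) + a + b - 1 = a + b + 2 * ((k : ℝ) + 1 + e) - 2 - e := by ring
    rw [hD]
    have hq := div_mul_cancel₀ (a + ((k : ℝ) + 1 + e) - 1 - e) hne
    linear_combination (((k : ℝ) + a) * Z * (-1) ^ e) * hc
      - (((e : ℝ) + 1) * (-1) ^ e * ((k + 1 + e).choose k : ℝ) * Z) * hq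
  · rw [coeff_jacobi d a b (k + 1), Nat.choose_eq_zero_of_lt (Nat.lt_succ_of_le h)]
    rcases h.eq_or_lt with rfl | h
    · simp
    · rw [coeff_jacobi, Nat.choose_eq_zero_of_lt h]
      simp

theorem jacobi_ode (d : ℕ) {a b : ℝ} (hab : 0 < a + b) :
    X * (X - 1) * derivative (derivative (jacobi d a b))
      + (C (a + b) * X - C a) * derivative (jacobi d a b)
      = C (d * (d + a + b - 1)) * jacobi d a b := by
  set p := jacobi d a b with hp
  have h : X * (X - 1) * derivative (derivative p) + (C (a + b) * X - C a) * derivative p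
      = X * derivative (X * derivative p) - X * derivative p - X * derivative (derivative p)
        + C (a + b) * (X * derivative p) - C a * derivative p := by
    rw [derivative_mul, derivative_X]
    ring
  rw [h]
  ext k
  simp only [coeff_add, coeff_sub, coeff_C_mul, coeff_X_mul_derivative, coeff_derivative]
  have := coeff_jacobi_recurrence d hab k
  rw [← hp] at this
  linear_combination -this

/-! ### Zeros of Jacobi polynomials -/

/-- The derivative of a product of distinct linear factors alternates in sign along the roots. -/
theorem neg_one_pow_mul_eval_derivative_nodal_pos {n : ℕ} {y : Fin n → ℝ} (hy : StrictMono y)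
    (i : Fin n) :
    0 < (-1) ^ (n - 1 - (i : ℕ)) * (derivative (Lagrange.nodal univ y)).eval (y i) := by
  rw [Lagrange.eval_nodal_derivative_eval_node_eq (mem_univ i), Lagrange.eval_nodal]
  have h : (-1 : ℝ) ^ (n - 1 - (i : ℕ)) = ∏ j ∈ univ.erase i, if i < j then (-1 : ℝ) else 1 := by
    rw [prod_ite, prod_const_one, mul_one, prod_const, ← Fin.card_Ioi]
    congr 2
    ext j
    simp only [mem_Ioi, mem_filter, mem_erase, mem_univ, and_true]
    exact ⟨fun h => ⟨h.ne', h⟩, fun h => h.2⟩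
  rw [h, ← prod_mul_distrib]
  refine prod_pos fun j hj => ?_
  rcases lt_or_gt_of_ne (ne_of_mem_erase hj) with h | h
  · rw [if_neg h.not_gt]
    linarith [hy h]
  · rw [if_pos h]
    linarith [hy h]

/-- The points of `y` together with `0` in front and `1` at the end. -/
def withEndpoints {n : ℕ} (y : Fin n → ℝ) : Fin (n + 2) → ℝ :=
  Fin.cons 0 (Fin.snoc y 1 : Fin (n + 1) → ℝ)

@[simp] theorem withEndpoints_zero {n : ℕ} (y : Fin n → ℝ) : withEndpoints y 0 = 0 := rfl

@[simp] theorem withEndpoints_castSucc {n : ℕ} (y : Fin n → ℝ) (i : Fin n) :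
    withEndpoints y i.castSucc.succ = y i := by
  simp [withEndpoints]

@[simp] theorem withEndpoints_last {n : ℕ} (y : Fin n → ℝ) :
    withEndpoints y (Fin.last (n + 1)) = 1 := by
  rw [← Fin.succ_last]
  simp [withEndpoints]

theorem strictMono_withEndpoints {n : ℕ} {y : Fin n → ℝ} (hy : StrictMono y)
    (h01 : ∀ i, y i ∈ Set.Ioo (0 : ℝ) 1) : StrictMono (withEndpoints y) := by
  intro i j hij
  induction j using Fin.cases with
  | zero => exact absurd hij (Fin.not_lt_zero i)
  | succ j =>
    induction i using Fin.cases with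
    | zero =>
      induction j using Fin.lastCases with
      | last => simp
      | cast j => simpa using (h01 j).1
    | succ i =>
      rw [Fin.succ_lt_succ_iff] at hij
      induction i using Fin.lastCases with
      | last => exact absurd hij (Fin.le_last j).not_gt
      | cast i =>
        induction j using Fin.lastCases with
        | last => simpa using (h01 i).2
        | cast j => simpa using hy (Fin.castSucc_lt_castSucc_iff.1 hij)

theorem nodal_withEndpoints {n : ℕ} (y : Fin n → ℝ) :
    Lagrange.nodal univ (withEndpoints y) = X * (X - 1) * Lagrange.nodal univ y := by
  simp only [Lagrange.nodal]
  rw [Fin.prod_univ_succ, Fin.prod_univ_castSucc]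
  simp only [withEndpoints_zero, withEndpoints_castSucc, Fin.succ_last, withEndpoints_last, map_zero,
    map_one]
  ring

/-- A monic polynomial of degree `n` whose signs alternate along `n + 1` points has a simple root
in each of the gaps and no others. -/
theorem exists_roots_of_alternating {n : ℕ} {g : ℝ[X]} (hg : g.Monic) (hd : g.natDegree = n)
    {z : Fin (n + 1) → ℝ} (hz : StrictMono z)
    (hs : ∀ i : Fin (n + 1), 0 < (-1) ^ (n - (i : ℕ)) * g.eval (z i)) :
    ∃ w : Fin n → ℝ, StrictMono w ∧ (∀ i, w i ∈ Set.Ioo (z i.castSucc) (z i.succ)) ∧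
      g = Lagrange.nodal univ w := by
  have key : ∀ i : Fin n, ∃ w ∈ Set.Ioo (z i.castSucc) (z i.succ), g.eval w = 0 := by
    intro i
    have h1 := hs i.castSucc
    have h2 := hs i.succ
    rw [Fin.val_castSucc] at h1
    rw [Fin.val_succ] at h2
    rw [show n - (i : ℕ) = n - (i + 1) + 1 by omega, pow_succ] at h1
    have hlt : z i.castSucc < z i.succ := hz i.castSucc_lt_succ
    have hcont : ContinuousOn (fun t => (-1 : ℝ) ^ (n - (i + 1)) * g.eval t)
        (Set.Icc (z i.castSucc) (z i.succ)) := by fun_prop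
    obtain ⟨w, hw, hw0⟩ := intermediate_value_Ioo hlt.le hcont
      (show (0 : ℝ) ∈ Set.Ioo _ _ from ⟨by linarith, h2⟩)
    exact ⟨w, hw, (mul_eq_zero.1 hw0).resolve_left (pow_ne_zero _ (by norm_num))⟩
  choose w hw hw0 using key
  have hmono : StrictMono w := by
    intro i j hij
    exact (hw i).2.trans_le ((hz.monotone (Fin.le_def.2 (by simpa using hij))).trans (hw j).1.le)
  refine ⟨w, hmono, hw, ?_⟩
  refine Polynomial.eq_of_monic_of_dvd_of_natDegree_le Lagrange.nodal_monic hg ?_ ?_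
  · refine Finset.prod_dvd_of_coprime (fun i _ j _ hij => ?_) fun i _ => dvd_iff_isRoot.2 (hw0 i)
    exact pairwise_coprime_X_sub_C hmono.injective hij
  · rw [hd, Lagrange.natDegree_nodal, card_univ, Fintype.card_fin]

theorem jacobi_eq_nodal (d : ℕ) {a b : ℝ} (ha : 0 < a) (hb : 0 < b) :
    ∃ y : Fin d → ℝ, StrictMono y ∧ (∀ i, y i ∈ Set.Ioo (0 : ℝ) 1) ∧
      jacobi d a b = Lagrange.nodal univ y := by
  induction d generalizing a b with
  | zero => exact ⟨Fin.elim0, fun i => i.elim0, fun i => i.elim0, by simp [jacobi]⟩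
  | succ d ih =>
    obtain ⟨y, hy, h01, hf⟩ := ih (a := a + 1) (b := b + 1) (by linarith) (by linarith)
    have hz := strictMono_withEndpoints hy h01
    have hode := jacobi_ode (d + 1) (add_pos ha hb)
    have hder : derivative (jacobi (d + 1) a b) = C ((d : ℝ) + 1) * Lagrange.nodal univ y := by
      rw [derivative_jacobi, hf]
    set g := jacobi (d + 1) a b
    have hd0 : (0 : ℝ) ≤ d := d.cast_nonneg
    -- By the differential equation, `g` has at the nodes `0, y, 1` the sign of the derivative of
    -- the nodal polynomial, with a different positive factor at the two endpoints.
    have hval : ∀ i : Fin (d + 2), ∃ κ : ℝ, 0 < κ ∧ g.eval (withEndpoints y i) =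
        κ * (derivative (Lagrange.nodal univ (withEndpoints y))).eval (withEndpoints y i) := by
      intro i
      have hN : (0 : ℝ) < (d + 1) * (d + a + b) :=
        mul_pos (by linarith) (by linarith)
      have h := congrArg (eval (withEndpoints y i)) hode
      rw [hder] at h
      rw [nodal_withEndpoints]
      simp only [derivative_mul, derivative_C, eval_add, eval_mul, eval_sub, eval_X, eval_C,
        eval_one, derivative_X, derivative_one, derivative_sub, zero_mul, zero_add, sub_zero,
        one_mul, mul_one] at h ⊢
      push_cast at h
      induction i using Fin.cases with
      | zero =>
        refine ⟨a * (d + 1) / ((d + 1) * (d + a + b)), by positivity, ?_⟩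
        simp only [withEndpoints_zero] at h ⊢
        rw [div_mul_eq_mul_div, eq_div_iff hN.ne']
        linear_combination -h
      | succ i =>
        induction i using Fin.lastCases with
        | last =>
          refine ⟨b * (d + 1) / ((d + 1) * (d + a + b)), by positivity, ?_⟩
          simp only [Fin.succ_last, withEndpoints_last] at h ⊢
          rw [div_mul_eq_mul_div, eq_div_iff hN.ne']
          linear_combination -h
        | cast i =>
          refine ⟨(d + 1) / ((d + 1) * (d + a + b)), by positivity, ?_⟩
          simp only [withEndpoints_castSucc] at h ⊢
          rw [Lagrange.eval_nodal_at_node (mem_univ i)] at h ⊢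
          rw [div_mul_eq_mul_div, eq_div_iff hN.ne']
          linear_combination -h
    obtain ⟨w, hw, hwz, hgw⟩ := exists_roots_of_alternating (monic_jacobi (d + 1) a b)
      (natDegree_jacobi (d + 1) a b) hz fun i => by
        obtain ⟨κ, hκ, h⟩ := hval i
        rw [h, mul_left_comm]
        exact mul_pos hκ (neg_one_pow_mul_eval_derivative_nodal_pos hz i)
    refine ⟨w, hw, fun i => ⟨?_, ?_⟩, hgw⟩
    · exact (hz.monotone (Fin.zero_le i.castSucc)).trans_lt (hwz i).1
    · have := hz.monotone (Fin.le_last i.succ)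
      rw [withEndpoints_last] at this
      exact (hwz i).2.trans_le this

/-! ### Interlacing zeros and the signed quadrature formula -/

/-- The points `y` are nodes of a quadrature formula with alternating weights `±1`, the last one
positive, exact in degree at most `n`. -/
def SignedQuadrature {n : ℕ} (y : Fin n → ℝ) (δ θ : ℝ) : Prop :=
  ∀ q : ℝ[X], q.natDegree ≤ n →
    ∑ i : Fin n, (-1) ^ (n - 1 - (i : ℕ)) * q.eval (y i) = θ * q.eval 1 + (δ - θ) * q.eval 0

/-- A Wronskian-type identity: its left-hand side is, up to a weight, the Wronskian of two solutions
of one hypergeometric equation, namely `A` and the product of `B` with `x ^ (δ - θ) * (x - 1) ^ θ`.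
-/
theorem jacobi_wronskian (m e : ℕ) {θ : ℝ} (he : (e : ℝ) < 2) :
    ∃ K : ℝ, X * (X - 1) *
        (derivative (jacobi (m + e) (1 - e + θ) (1 - θ)) * jacobi m (1 + e - θ) (1 + θ)
          - jacobi (m + e) (1 - e + θ) (1 - θ) * derivative (jacobi m (1 + e - θ) (1 + θ)))
      - (C (e : ℝ) * (X - 1) + C θ) *
        (jacobi (m + e) (1 - e + θ) (1 - θ) * jacobi m (1 + e - θ) (1 + θ)) = C K := by
  have hA := jacobi_ode (m + e) (a := 1 - e + θ) (b := 1 - θ) (by linarith)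
  have hB := jacobi_ode m (a := 1 + e - θ) (b := 1 + θ)
    (by linarith [(Nat.cast_nonneg e : (0 : ℝ) ≤ e)])
  set A := jacobi (m + e) (1 - e + θ) (1 - θ)
  set B := jacobi m (1 + e - θ) (1 + θ)
  refine ⟨_, eq_C_of_natDegree_eq_zero (Polynomial.derivative_eq_zero.1 ?_)⟩
  simp only [derivative_mul, derivative_C, derivative_X, derivative_one, derivative_sub,
    derivative_add]
  push_cast at hA hB
  simp only [C_add, C_sub, C_mul, C_1] at hA hB
  linear_combination B * hA - A * hB

theorem eval_nodal_one_pos {n : ℕ} {y : Fin n → ℝ} (h01 : ∀ i, y i ∈ Set.Ioo (0 : ℝ) 1) :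
    0 < (Lagrange.nodal univ y).eval 1 := by
  rw [Lagrange.eval_nodal]
  exact prod_pos fun i _ => sub_pos.2 (h01 i).2

theorem eval_nodal_eq_zero_iff {n : ℕ} {y : Fin n → ℝ} {r : ℝ} :
    (Lagrange.nodal univ y).eval r = 0 ↔ ∃ i, y i = r := by
  rw [Lagrange.eval_nodal, prod_eq_zero_iff]
  simp only [mem_univ, true_and, sub_eq_zero, eq_comm]

/-- Two families of distinct points without a common member can be merged into one increasing
family. -/
theorem exists_merge {d m n : ℕ} (hn : d + m = n) {u : Fin d → ℝ} {v : Fin m → ℝ}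
    (hu : Function.Injective u) (hv : Function.Injective v) (huv : ∀ i j, u i ≠ v j) :
    ∃ y : Fin n → ℝ, StrictMono y ∧
      Lagrange.nodal univ u * Lagrange.nodal univ v = Lagrange.nodal univ y := by
  have hdisj : Disjoint (univ.map ⟨u, hu⟩) (univ.map ⟨v, hv⟩) := by
    rw [Finset.disjoint_left]
    intro r h1 h2
    obtain ⟨i, -, rfl⟩ := mem_map.1 h1
    obtain ⟨j, -, h⟩ := mem_map.1 h2
    exact huv i j h.symm
  have hc : ((univ.map ⟨u, hu⟩).disjUnion (univ.map ⟨v, hv⟩) hdisj).card = n := by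
    rw [card_disjUnion, card_map, card_map, card_univ, card_univ, Fintype.card_fin,
      Fintype.card_fin, hn]
  refine ⟨_, (Finset.orderEmbOfFin _ hc).strictMono, ?_⟩
  have h : ∏ r ∈ univ.map (Finset.orderEmbOfFin _ hc).toEmbedding, (X - C r) =
      ∏ r ∈ (univ.map ⟨u, hu⟩).disjUnion (univ.map ⟨v, hv⟩) hdisj, (X - C r) := by
    rw [map_orderEmbOfFin_univ]
  rw [prod_disjUnion, prod_map, prod_map, prod_map] at h
  exact h.symm

/-- The quadrature formula attached to a pair `A`, `B` satisfying the Wronskian identity. As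
`x (x - 1) (A' B - A B')` equals the constant `K < 0` at every zero of `A B`, the derivative of
`A B` is positive at the zeros of `A` and negative at those of `B`; this forces the interlacing, and
identifies the alternating weights with the Lagrange weights of the nodes `0, y, 1`. -/
theorem exists_interleaved_quadrature {d m n : ℕ} (hn : d + m = n) {δ θ K : ℝ} (hθ : 0 < θ)
    {A B : ℝ[X]} {u : Fin d → ℝ} {v : Fin m → ℝ} (hu : StrictMono u) (hv : StrictMono v)
    (hu01 : ∀ i, u i ∈ Set.Ioo (0 : ℝ) 1) (hv01 : ∀ i, v i ∈ Set.Ioo (0 : ℝ) 1)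
    (hA : A = Lagrange.nodal univ u) (hB : B = Lagrange.nodal univ v)
    (hW : X * (X - 1) * (derivative A * B - A * derivative B)
      - (C δ * (X - 1) + C θ) * (A * B) = C K) :
    ∃ y : Fin n → ℝ, AreInterleavedRoots y A B ∧ SignedQuadrature y δ θ := by
  have hWe : ∀ r : ℝ, r * (r - 1) * ((derivative A).eval r * B.eval r
      - A.eval r * (derivative B).eval r) - (δ * (r - 1) + θ) * (A.eval r * B.eval r) = K := by
    intro r
    simpa using congrArg (eval r) hW
  have hA1 : 0 < A.eval 1 := hA ▸ eval_nodal_one_pos hu01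
  have hB1 : 0 < B.eval 1 := hB ▸ eval_nodal_one_pos hv01
  have hK1 : K = -(θ * (A.eval 1 * B.eval 1)) := by
    rw [← hWe 1]
    ring
  have hK0 : K = (δ - θ) * (A.eval 0 * B.eval 0) := by
    rw [← hWe 0]
    ring
  have hK : K < 0 := by
    rw [hK1]
    exact neg_neg_of_pos (by positivity)
  have hArt : ∀ {r}, A.eval r = 0 ↔ ∃ i, u i = r := hA ▸ eval_nodal_eq_zero_iff
  have hBrt : ∀ {r}, B.eval r = 0 ↔ ∃ i, v i = r := hB ▸ eval_nodal_eq_zero_iff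
  have hcop : ∀ r, A.eval r = 0 → B.eval r = 0 → False := by
    intro r h1 h2
    have := hWe r
    rw [h1, h2] at this
    apply hK.ne
    rw [← this]
    ring
  obtain ⟨y, hy, hAB⟩ := exists_merge hn hu.injective hv.injective fun i j h =>
    hcop (u i) (hArt.2 ⟨i, rfl⟩) (hBrt.2 ⟨j, h.symm⟩)
  rw [← hA, ← hB] at hAB
  have hyrt : ∀ i, A.eval (y i) = 0 ∨ B.eval (y i) = 0 := by
    intro i
    rw [← mul_eq_zero, ← eval_mul, hAB]
    exact eval_nodal_eq_zero_iff.2 ⟨i, rfl⟩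
  have hy01 : ∀ i, y i ∈ Set.Ioo (0 : ℝ) 1 := by
    intro i
    rcases hyrt i with h | h
    · obtain ⟨j, hj⟩ := hArt.1 h
      exact hj ▸ hu01 j
    · obtain ⟨j, hj⟩ := hBrt.1 h
      exact hj ▸ hv01 j
  have hneg : ∀ i, y i * (y i - 1) < 0 := fun i =>
    mul_neg_of_pos_of_neg (hy01 i).1 (sub_neg.2 (hy01 i).2)
  have hder : ∀ i, (derivative (Lagrange.nodal univ y)).eval (y i) =
      (derivative A).eval (y i) * B.eval (y i) + A.eval (y i) * (derivative B).eval (y i) := by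
    intro i
    rw [← hAB, derivative_mul]
    simp
  -- At each node the weight is `K` over the derivative of the nodal polynomial of `0, y, 1`.
  have hwt : ∀ i : Fin n, (-1 : ℝ) ^ (n - 1 - (i : ℕ)) *
        (y i * (y i - 1) * (derivative (Lagrange.nodal univ y)).eval (y i)) = K ∧
      (A.eval (y i) = 0 ↔ Even (n - 1 - (i : ℕ))) := by
    intro i
    have hs := neg_one_pow_mul_eval_derivative_nodal_pos hy i
    have hd := hder i
    have hWi := hWe (y i)
    rcases hyrt i with h | h
    · rw [h, zero_mul, add_zero] at hd
      rw [h] at hWi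
      have hmul : y i * (y i - 1) * (derivative (Lagrange.nodal univ y)).eval (y i) = K := by
        rw [hd]
        linear_combination hWi
      have hpos : 0 < (derivative (Lagrange.nodal univ y)).eval (y i) :=
        by
        by_contra hle
        have := mul_nonneg_of_nonpos_of_nonpos (hneg i).le (not_lt.1 hle)
        linarith
      rcases Nat.even_or_odd (n - 1 - (i : ℕ)) with he | ho
      · rw [he.neg_one_pow]
        exact ⟨by rw [one_mul, hmul], by simp [h, he]⟩
      · rw [ho.neg_one_pow] at hs
        linarith
    · have hA0 : A.eval (y i) ≠ 0 := fun h0 => hcop _ h0 h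
      rw [h, mul_zero, zero_add] at hd
      rw [h] at hWi
      have hmul : y i * (y i - 1) * (derivative (Lagrange.nodal univ y)).eval (y i) = -K := by
        rw [hd]
        linear_combination -hWi
      have hlt : (derivative (Lagrange.nodal univ y)).eval (y i) < 0 := by
        by_contra hge
        have := mul_nonpos_of_nonpos_of_nonneg (hneg i).le (not_lt.1 hge)
        linarith
      rcases Nat.even_or_odd (n - 1 - (i : ℕ)) with he | ho
      · rw [he.neg_one_pow] at hs
        linarith
      · rw [ho.neg_one_pow]
        exact ⟨by rw [hmul]; ring, by simp [hA0, ho]⟩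
  have hAmonic : A.Monic := hA ▸ Lagrange.nodal_monic
  have hBmonic : B.Monic := hB ▸ Lagrange.nodal_monic
  have hpar : ∀ i : Fin n, ((i : ℕ) + 1) % 2 = n % 2 ↔ A.eval (y i) = 0 := by
    intro i
    rw [(hwt i).2, Nat.even_iff]
    have := i.2
    omega
  have hpar' : ∀ i : Fin n, ((i : ℕ) + 1) % 2 ≠ n % 2 ↔ B.eval (y i) = 0 := by
    intro i
    rw [Ne, hpar]
    exact ⟨(hyrt i).resolve_left, fun h h' => hcop _ h' h⟩
  have hroots : ∀ (w : ℝ), A.eval w = 0 ∨ B.eval w = 0 → ∃ i, y i = w := by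
    intro w hw
    rwa [← mul_eq_zero, ← eval_mul, hAB, eval_nodal_eq_zero_iff] at hw
  have hnodup : ∀ {k : ℕ} {w : Fin k → ℝ}, StrictMono w →
      (Lagrange.nodal univ w).roots.Nodup := by
    intro k w hw
    have h : Lagrange.nodal univ w = ((univ.val.map w).map fun r => X - C r).prod := by
      rw [Multiset.map_map]
      rfl
    rw [h, roots_multiset_prod_X_sub_C]
    exact univ.nodup.map hw.injective
  refine ⟨y, ⟨hy, hy01, ?_, ?_⟩, ?_⟩
  · refine (Multiset.Nodup.ext (hA ▸ hnodup hu)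
      ((Finset.nodup _).map hy.injective)).2 fun r => ?_
    rw [mem_roots hAmonic.ne_zero, IsRoot.def, Multiset.mem_map]
    simp only [mem_val, mem_filter, mem_univ, true_and, hpar]
    constructor
    · intro h
      obtain ⟨i, rfl⟩ := hroots r (Or.inl h)
      exact ⟨i, h, rfl⟩
    · rintro ⟨i, h, rfl⟩
      exact h
  · refine (Multiset.Nodup.ext (hB ▸ hnodup hv)
      ((Finset.nodup _).map hy.injective)).2 fun r => ?_
    rw [mem_roots hBmonic.ne_zero, IsRoot.def, Multiset.mem_map]
    simp only [mem_val, mem_filter, mem_univ, true_and, hpar']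
    constructor
    · intro h
      obtain ⟨i, rfl⟩ := hroots r (Or.inr h)
      exact ⟨i, h, rfl⟩
    · rintro ⟨i, h, rfl⟩
      exact h
  · intro q hq
    have hz := strictMono_withEndpoints hy hy01
    have hcard : #(univ : Finset (Fin (n + 2))) = n + 2 := by simp
    have hsum := Lagrange.coeff_eq_sum (s := univ) hz.injective.injOn (P := q) (by
      rw [hcard]
      exact (degree_le_natDegree).trans_lt (by exact_mod_cast (by omega : q.natDegree < n + 2)))
    rw [hcard, coeff_eq_zero_of_natDegree_lt (by omega)] at hsum
    simp only [← Lagrange.eval_nodal, ← Lagrange.eval_nodal_derivative_eval_node_eq (mem_univ _)]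
      at hsum
    rw [nodal_withEndpoints, Fin.sum_univ_succ, Fin.sum_univ_castSucc] at hsum
    have hnod : (derivative (X * (X - 1) * Lagrange.nodal univ y)) =
        (2 * X - 1) * Lagrange.nodal univ y + X * (X - 1) * derivative (Lagrange.nodal univ y) := by
      simp only [derivative_mul, derivative_X, derivative_sub, derivative_one]
      ring
    simp only [hnod, withEndpoints_zero, withEndpoints_castSucc, Fin.succ_last, withEndpoints_last,
      eval_add, eval_mul, eval_sub, eval_X, eval_one, eval_ofNat,
      Lagrange.eval_nodal_at_node (mem_univ _)] at hsum
    have hF : ∀ r, (Lagrange.nodal univ y).eval r = A.eval r * B.eval r := by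
      intro r
      rw [← hAB, eval_mul]
    have hF0 : (Lagrange.nodal univ y).eval 0 ≠ 0 := by
      rw [Ne, eval_nodal_eq_zero_iff]
      rintro ⟨i, hi⟩
      exact (hy01 i).1.ne' hi
    have hF1 : (Lagrange.nodal univ y).eval 1 ≠ 0 := (eval_nodal_one_pos hy01).ne'
    have hterm : ∀ i : Fin n, (-1 : ℝ) ^ (n - 1 - (i : ℕ)) * q.eval (y i) =
        K * (q.eval (y i) / ((2 * y i - 1) * 0 +
          y i * (y i - 1) * (derivative (Lagrange.nodal univ y)).eval (y i))) := by
      intro i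
      rw [mul_zero, zero_add, mul_div_assoc', eq_div_iff, ← (hwt i).1]
      · ring
      · intro h0
        have := (hwt i).1
        rw [h0, mul_zero] at this
        exact hK.ne this.symm
    rw [sum_congr rfl fun i _ => hterm i, ← mul_sum]
    rw [← hF] at hK0 hK1
    have h0 : K * (q.eval 0 / ((2 * 0 - 1) * (Lagrange.nodal univ y).eval 0 +
        0 * (0 - 1) * (derivative (Lagrange.nodal univ y)).eval 0)) = -((δ - θ) * q.eval 0) := by
      rw [show ∀ c e : ℝ, (2 * 0 - 1) * c + 0 * (0 - 1) * e = -c from fun c e => by ring, hK0]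
      field_simp
    have h1 : K * (q.eval 1 / ((2 * 1 - 1) * (Lagrange.nodal univ y).eval 1 +
        1 * (1 - 1) * (derivative (Lagrange.nodal univ y)).eval 1)) = -(θ * q.eval 1) := by
      rw [show ∀ c e : ℝ, (2 * 1 - 1) * c + 1 * (1 - 1) * e = c from fun c e => by ring, hK1]
      field_simp
    linear_combination (-K) * hsum - h0 - h1

/-- The interlacing pairs of Jacobi polynomials; their reciprocal polynomials are the numerator and
the denominator of a Padé approximant of `(1 - x) ^ θ`. -/
theorem exists_interleaved_jacobi (m e : ℕ) {n : ℕ} (hn : m + e + m = n) (he : e ≤ 1) {θ : ℝ}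
    (h0 : 0 < θ) (h1 : θ < 1) :
    ∃ y : Fin n → ℝ,
      AreInterleavedRoots y (jacobi (m + e) (1 - e + θ) (1 - θ)) (jacobi m (1 + e - θ) (1 + θ)) ∧
      SignedQuadrature y e θ := by
  have he' : (e : ℝ) ≤ 1 := by exact_mod_cast he
  have he0 : (0 : ℝ) ≤ e := e.cast_nonneg
  obtain ⟨u, hu, hu01, hA⟩ := jacobi_eq_nodal (m + e) (a := 1 - e + θ) (b := 1 - θ)
    (by linarith) (by linarith)
  obtain ⟨v, hv, hv01, hB⟩ := jacobi_eq_nodal m (a := 1 + e - θ) (b := 1 + θ)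
    (by linarith) (by linarith)
  obtain ⟨K, hK⟩ := jacobi_wronskian m e (θ := θ) (by linarith)
  exact exists_interleaved_quadrature hn h0 hu hv hu01 hv01 hA hB hK

/-! ### Power sums determine a finite family -/

/-- By Newton's identities, in characteristic zero the first `n` power sums of `n` elements
determine the elementary symmetric functions, hence the multiset of the elements. -/
theorem map_eq_map_of_sum_pow_eq {n : ℕ} {u v : Fin n → ℝ}
    (h : ∀ j ≤ n, ∑ i, u i ^ j = ∑ i, v i ^ j) :
    (univ : Finset (Fin n)).val.map u = (univ : Finset (Fin n)).val.map v := by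
  have hes : ∀ k ≤ n, MvPolynomial.aeval u (MvPolynomial.esymm (Fin n) ℝ k) =
      MvPolynomial.aeval v (MvPolynomial.esymm (Fin n) ℝ k) := by
    intro k
    induction k using Nat.strong_induction_on with
    | _ k ih =>
      intro hk
      rcases Nat.eq_zero_or_pos k with rfl | hpos
      · simp
      · have hN := MvPolynomial.mul_esymm_eq_sum (Fin n) ℝ k
        have hu := congrArg (MvPolynomial.aeval u) hN
        have hv := congrArg (MvPolynomial.aeval v) hN
        simp only [map_mul, map_natCast, map_sum, map_pow, map_neg, map_one] at hu hv
        have hk0 : (k : ℝ) ≠ 0 := by exact_mod_cast hpos.ne'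
        apply mul_left_cancel₀ hk0
        rw [hu, hv]
        congr 1
        refine sum_congr rfl fun a ha => ?_
        rw [mem_filter, HasAntidiagonal.mem_antidiagonal] at ha
        rw [ih a.1 ha.2 (by omega)]
        congr 1
        simp only [MvPolynomial.psum, map_sum, map_pow, MvPolynomial.aeval_X]
        exact h _ (by omega)
  have hp : (((univ : Finset (Fin n)).val.map u).map fun r => X - C r).prod =
      (((univ : Finset (Fin n)).val.map v).map fun r => X - C r).prod := by
    rw [Multiset.prod_X_sub_X_eq_sum_esymm, Multiset.prod_X_sub_X_eq_sum_esymm]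
    simp only [Multiset.card_map]
    refine sum_congr rfl fun k hk => ?_
    have := hes k (by simpa [Nat.lt_succ_iff] using hk)
    rw [MvPolynomial.aeval_esymm_eq_multiset_esymm, MvPolynomial.aeval_esymm_eq_multiset_esymm]
      at this
    rw [this]
  simpa only [roots_multiset_prod_X_sub_C] using congrArg roots hp

theorem eq_of_monotone_of_map_eq {n : ℕ} {x y : Fin n → ℝ} (hx : Monotone x) (hy : Monotone y)
    (h : (univ : Finset (Fin n)).val.map x = (univ : Finset (Fin n)).val.map y) : x = y := by
  rw [Fin.univ_val_map, Fin.univ_val_map, Multiset.coe_eq_coe] at h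
  exact List.ofFn_injective (h.eq_of_sortedLE hx.sortedLE_ofFn hy.sortedLE_ofFn)

/-- Signed power sums determine `x` among the monotone families, given one solution `y` whose
entries are distinct: moving the negative terms to the other side turns the hypothesis into an
equality of ordinary power sums. -/
theorem eq_of_signed_sum_pow_eq {n : ℕ} {x y : Fin n → ℝ} (hx : Monotone x) (hy : StrictMono y)
    (h : ∀ j ≤ n, ∑ i : Fin n, (-1) ^ (n - 1 - (i : ℕ)) * x i ^ j
      = ∑ i : Fin n, (-1) ^ (n - 1 - (i : ℕ)) * y i ^ j) : x = y := by
  let p : Fin n → Prop := fun i => Even (n - 1 - (i : ℕ))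
  let E : Multiset (Fin n) := (univ : Finset (Fin n)).val.filter p
  let O : Multiset (Fin n) := (univ : Finset (Fin n)).val.filter fun i => ¬ p i
  have hEO : E + O = (univ : Finset (Fin n)).val := Multiset.filter_add_not p _
  have hswap : ∀ s t : Fin n → ℝ,
      (univ : Finset (Fin n)).val.map (fun i => if p i then s i else t i) = E.map s + O.map t := by
    intro s t
    rw [← hEO, Multiset.map_add]
    congr 1
    · exact Multiset.map_congr rfl fun i hi => if_pos (Multiset.mem_filter.1 hi).2
    · exact Multiset.map_congr rfl fun i hi => if_neg (Multiset.mem_filter.1 hi).2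
  have key : E.map x + O.map y = E.map y + O.map x := by
    rw [← hswap, ← hswap]
    refine map_eq_map_of_sum_pow_eq fun j hj => ?_
    rw [← sub_eq_zero, ← sum_sub_distrib]
    have := h j hj
    rw [← sub_eq_zero, ← sum_sub_distrib] at this
    rw [← this]
    refine sum_congr rfl fun i _ => ?_
    by_cases hi : p i
    · simp only [if_pos hi, Even.neg_one_pow hi]
      ring
    · simp only [if_neg hi, Odd.neg_one_pow (Nat.not_even_iff_odd.1 hi)]
      ring
  have hdisj : Disjoint (E.map y) (O.map y) := by
    rw [Multiset.disjoint_left]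
    intro r h1 h2
    obtain ⟨i, hi, rfl⟩ := Multiset.mem_map.1 h1
    obtain ⟨j, hj, hij⟩ := Multiset.mem_map.1 h2
    rw [hy.injective hij] at hj
    exact (Multiset.mem_filter.1 hj).2 (Multiset.mem_filter.1 hi).2
  have hE : E.map y = E.map x := by
    refine Multiset.eq_of_le_of_card_le ?_ (by simp)
    rw [Multiset.le_iff_count]
    intro r
    by_cases hr : r ∈ E.map y
    · have hc := congrArg (Multiset.count r) key
      rw [Multiset.count_add, Multiset.count_add,
        Multiset.count_eq_zero_of_notMem (Multiset.disjoint_left.1 hdisj hr)] at hc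
      omega
    · rw [Multiset.count_eq_zero_of_notMem hr]
      exact Nat.zero_le _
  rw [hE] at key
  have hO : O.map y = O.map x := add_left_cancel key
  refine eq_of_monotone_of_map_eq hx hy.monotone ?_
  rw [← hEO, Multiset.map_add, Multiset.map_add, hE, hO]

/-! ### Integrals against a switch function -/

theorem one_sub_two_mul_sum_neg_one_pow (m : ℕ) :
    (1 : ℝ) - 2 * ∑ i ∈ range m, (-1 : ℝ) ^ i = (-1) ^ m := by
  induction m with
  | zero => simp
  | succ m ih =>
    rw [sum_range_succ, pow_succ]
    linear_combination ih

/-- A switch function as a combination of step functions. -/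
theorem switch_eq_sum {n : ℕ} {x : Fin n → ℝ} (hx : Monotone x) (t : ℝ) :
    switch x t = 1 - 2 * ∑ i : Fin n, (-1) ^ (i : ℕ) * Set.indicator (Set.Ici (x i)) 1 t := by
  set m := #{i : Fin n | x i ≤ t} with hm
  -- The switch points up to `t` form an initial segment.
  have hmem : ∀ i : Fin n, x i ≤ t ↔ (i : ℕ) < m := by
    intro i
    constructor
    · intro hi
      have : Finset.Iic i ⊆ univ.filter fun i : Fin n => x i ≤ t := fun j hj =>
        mem_filter.2 ⟨mem_univ _, (hx (mem_Iic.1 hj)).trans hi⟩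
      have := card_le_card this
      rw [Fin.card_Iic] at this
      omega
    · intro hi
      by_contra hc
      have : (univ.filter fun i : Fin n => x i ≤ t) ⊆ Finset.Iio i := fun j hj => by
        rw [mem_Iio]
        by_contra hij
        exact hc ((hx (not_lt.1 hij)).trans (mem_filter.1 hj).2)
      have := card_le_card this
      rw [Fin.card_Iio] at this
      omega
  have hmn : m ≤ n := (card_le_univ _).trans_eq (Fintype.card_fin n)
  rw [switch, ← hm, ← one_sub_two_mul_sum_neg_one_pow]
  congr 2
  have h : ∀ i : Fin n, (-1 : ℝ) ^ (i : ℕ) * Set.indicator (Set.Ici (x i)) 1 t =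
      if (i : ℕ) < m then (-1 : ℝ) ^ (i : ℕ) else 0 := by
    intro i
    by_cases hi : x i ≤ t
    · simp [hi, (hmem i).1 hi]
    · simp [hi, mt (hmem i).2 hi]
  rw [sum_congr rfl fun i _ => h i,
    Fin.sum_univ_eq_sum_range (fun i => if i < m then (-1 : ℝ) ^ i else 0) n, ← sum_filter]
  congr 1
  ext i
  simp only [mem_range, mem_filter]
  omega

theorem integral_derivative (q : ℝ[X]) (a b : ℝ) :
    ∫ t in a..b, (derivative q).eval t = q.eval b - q.eval a :=
  intervalIntegral.integral_eq_sub_of_hasDerivAt (fun t _ => q.hasDerivAt t)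
    ((derivative q).continuous.intervalIntegrable _ _)

theorem integral_indicator_mul_derivative (q : ℝ[X]) {c : ℝ} (hc : c ∈ Set.Icc (0 : ℝ) 1) :
    ∫ t in (0 : ℝ)..1, Set.indicator (Set.Ici c) 1 t * (derivative q).eval t
      = q.eval 1 - q.eval c := by
  have h : ∀ t, Set.indicator (Set.Ici c) 1 t * (derivative q).eval t =
      Set.indicator (Set.Ici c) (fun t => (derivative q).eval t) t := by
    intro t
    by_cases ht : t ∈ Set.Ici c
    · simp [Set.indicator_of_mem ht]
    · simp [Set.indicator_of_notMem ht]
  simp only [h]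
  have hint : ∀ a b, IntervalIntegrable
      (Set.indicator (Set.Ici c) fun t => (derivative q).eval t) MeasureTheory.volume a b := by
    intro a b
    have := ((derivative q).continuous.intervalIntegrable a b (μ := MeasureTheory.volume))
    exact ⟨this.1.indicator measurableSet_Ici, this.2.indicator measurableSet_Ici⟩
  rw [← intervalIntegral.integral_add_adjacent_intervals (hint 0 c) (hint c 1)]
  have h1 : ∫ t in (0 : ℝ)..c, Set.indicator (Set.Ici c) (fun t => (derivative q).eval t) t = 0 := by
    rw [intervalIntegral.integral_of_le hc.1, MeasureTheory.integral_Ioc_eq_integral_Ioo]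
    refine MeasureTheory.setIntegral_eq_zero_of_forall_eq_zero fun t ht => ?_
    exact Set.indicator_of_notMem (by simpa using ht.2) _
  have h2 : ∫ t in c..1, Set.indicator (Set.Ici c) (fun t => (derivative q).eval t) t =
      ∫ t in c..1, (derivative q).eval t := by
    refine intervalIntegral.integral_congr fun t ht => ?_
    rw [Set.uIcc_of_le hc.2] at ht
    exact Set.indicator_of_mem ht.1 _
  rw [h1, h2, integral_derivative, zero_add]

theorem pairing_derivative_switch {n : ℕ} {x : Fin n → ℝ} (hx : x ∈ simplex n) (l : ℝ) (q : ℝ[X]) :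
    pairing (fun t => (derivative q).eval t) (fun t => switch x t - l) =
      (1 - l) * (q.eval 1 - q.eval 0)
        - 2 * ∑ i : Fin n, (-1) ^ (i : ℕ) * (q.eval 1 - q.eval (x i)) := by
  have hint : ∀ i : Fin n, IntervalIntegrable (fun t => (-1 : ℝ) ^ (i : ℕ) *
      (Set.indicator (Set.Ici (x i)) 1 t * (derivative q).eval t)) MeasureTheory.volume 0 1 := by
    intro i
    refine IntervalIntegrable.const_mul ?_ _
    refine IntervalIntegrable.mul_continuousOn ?_ (derivative q).continuous.continuousOn
    have := (intervalIntegrable_const (c := (1 : ℝ)) (a := 0) (b := 1)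
      (μ := MeasureTheory.volume))
    exact ⟨this.1.indicator measurableSet_Ici, this.2.indicator measurableSet_Ici⟩
  have hfun : ∀ t, (switch x t - l) * (derivative q).eval t =
      (1 - l) * (derivative q).eval t - 2 * ∑ i : Fin n, (-1 : ℝ) ^ (i : ℕ) *
        (Set.indicator (Set.Ici (x i)) 1 t * (derivative q).eval t) := by
    intro t
    rw [switch_eq_sum hx.1]
    simp only [← mul_assoc, ← sum_mul]
    ring
  simp only [pairing, hfun]
  rw [intervalIntegral.integral_sub, intervalIntegral.integral_const_mul,
    intervalIntegral.integral_const_mul, intervalIntegral.integral_finsetSum,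
    integral_derivative]
  · congr 2
    refine sum_congr rfl fun i _ => ?_
    rw [intervalIntegral.integral_const_mul, integral_indicator_mul_derivative q (hx.2 i)]
  · exact fun i _ => hint i
  · exact ((derivative q).continuous.intervalIntegrable _ _).const_mul _
  · refine IntervalIntegrable.const_mul ?_ _
    simpa only [Finset.sum_fn] using IntervalIntegrable.sum univ fun i _ => hint i

theorem exists_derivative_eq {n : ℕ} {p : ℝ[X]} (hp : p.degree < n) :
    ∃ q : ℝ[X], derivative q = p ∧ q.natDegree ≤ n := by
  rcases eq_or_ne p 0 with rfl | h0
  · exact ⟨0, by simp⟩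
  refine ⟨∑ i ∈ range n, C (p.coeff i / (i + 1)) * X ^ (i + 1), ?_, ?_⟩
  · rw [derivative_sum]
    conv_rhs => rw [p.as_sum_range_C_mul_X_pow' ((natDegree_lt_iff_degree_lt h0).2 hp)]
    refine sum_congr rfl fun i _ => ?_
    have : (i : ℝ) + 1 ≠ 0 := i.cast_add_one_ne_zero
    rw [derivative_C_mul_X_pow, Nat.add_sub_cancel]
    push_cast
    rw [div_mul_cancel₀ _ this]
  · exact natDegree_sum_le_of_forall_le _ _ fun i hi =>
      (natDegree_C_mul_X_pow_le _ _).trans (mem_range.1 hi)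

/-- Every polynomial of degree less than `n` is the derivative of some `q` of degree at most `n`, and
the integral of `q'` against a switch function is a signed sum of values of `q`. -/
theorem orthogonal_iff_signedQuadrature {n : ℕ} {x : Fin n → ℝ} (hx : x ∈ simplex n) (l : ℝ) :
    Orthogonal x l ↔ SignedQuadrature x ((1 - (-1) ^ n) / 2) ((1 - (-1) ^ n * l) / 2) := by
  have hsq : ((-1 : ℝ) ^ n) * (-1) ^ n = 1 := by
    rw [← mul_pow]
    norm_num
  have key : ∀ q : ℝ[X],
      pairing (fun t => (derivative q).eval t) (fun t => switch x t - l) = 0 ↔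
      ∑ i : Fin n, (-1) ^ (n - 1 - (i : ℕ)) * q.eval (x i) = (1 - (-1) ^ n * l) / 2 * q.eval 1 +
        ((1 - (-1) ^ n) / 2 - (1 - (-1) ^ n * l) / 2) * q.eval 0 := by
    intro q
    have hsign : ∑ i : Fin n, (-1) ^ (n - 1 - (i : ℕ)) * q.eval (x i) =
        -(-1) ^ n * ∑ i : Fin n, (-1) ^ (i : ℕ) * q.eval (x i) := by
      rw [mul_sum]
      refine sum_congr rfl fun i _ => ?_
      obtain ⟨k, hk⟩ : ∃ k, n = k + 1 + i := ⟨n - 1 - i, by have := i.2; omega⟩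
      rw [show n - 1 - (i : ℕ) = k by omega, ← mul_assoc]
      congr 1
      have h2 : ((-1 : ℝ) ^ (i : ℕ)) * (-1) ^ (i : ℕ) = 1 := by
        rw [← mul_pow]
        norm_num
      have hpow : (-1 : ℝ) ^ n = (-1) ^ k * (-1) * (-1) ^ (i : ℕ) := by
        rw [← pow_succ, ← pow_add, ← hk]
      rw [hpow]
      linear_combination (-(-1) ^ k) * h2
    have hone := one_sub_two_mul_sum_neg_one_pow n
    rw [← Fin.sum_univ_eq_sum_range] at hone
    rw [pairing_derivative_switch hx, hsign]
    simp only [mul_sub, sum_sub_distrib, ← sum_mul]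
    generalize ∑ i : Fin n, (-1 : ℝ) ^ (i : ℕ) * q.eval (x i) = S
    generalize ∑ i : Fin n, (-1 : ℝ) ^ (i : ℕ) = T at hone ⊢
    rw [show T = (1 - (-1) ^ n) / 2 by linarith]
    generalize (-1 : ℝ) ^ n = s at hsq ⊢
    constructor
    · intro h
      linear_combination (-s / 2) * h + (q.eval 1 / 2) * hsq
    · intro h
      linear_combination (-2 * s) * h + (q.eval 0 * (1 - l) + l * q.eval 1 - 2 * S) * hsq
  constructor
  · intro h q hq
    refine (key q).1 (h _ ((degree_lt_iff_coeff_zero _ _).2 fun k hk => ?_))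
    rw [coeff_derivative, coeff_eq_zero_of_natDegree_lt (by omega), zero_mul]
  · intro h p hp
    obtain ⟨q, rfl, hq⟩ := exists_derivative_eq hp
    exact (key q).2 (h q hq)

/-! ### The polynomials of the theorem as Jacobi polynomials -/

theorem factorial_mul_choose_eq_prod (a : ℝ) (i : ℕ) :
    (i.factorial : ℝ) * Ring.choose a i = ∏ j ∈ range i, (a - j) := by
  rw [← nsmul_eq_mul, ← Ring.descPochhammer_eq_factorial_smul_choose]
  induction i with
  | zero => simp
  | succ i ih =>
    rw [descPochhammer_succ_right, smeval_mul, ih, prod_range_succ]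
    congr 1
    simp [smeval_sub, smeval_natCast]

theorem sum_choose_eq_jacobi {d N : ℕ} (hdN : d ≤ N) {a b s : ℝ} (hs : s = a + d - 1)
    (hN : (N : ℝ) = a + b + 2 * d - 2) :
    ∑ i ∈ range (d + 1), C ((-1) ^ i * (((d.factorial : ℝ) * ((N - i).factorial : ℝ)) /
        ((N.factorial : ℝ) * ((d - i).factorial : ℝ))) * Ring.choose s i) * X ^ (d - i)
      = jacobi d a b := by
  conv_rhs => rw [jacobi, ← sum_flip]
  refine sum_congr rfl fun i hi => ?_
  have hid : i ≤ d := Nat.lt_succ_iff.1 (mem_range.1 hi)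
  rw [Nat.sub_sub_self hid, Nat.choose_symm hid]
  congr 2
  rw [prod_div_distrib, ← hs, ← hN, ← factorial_mul_choose_eq_prod,
    ← factorial_mul_choose_eq_prod, Ring.choose_natCast, Nat.cast_choose ℝ hid,
    Nat.cast_choose ℝ (hid.trans hdN)]
  have h1 : (i.factorial : ℝ) ≠ 0 := by exact_mod_cast i.factorial_ne_zero
  have h2 : ((d - i).factorial : ℝ) ≠ 0 := by exact_mod_cast (d - i).factorial_ne_zero
  have h3 : ((N - i).factorial : ℝ) ≠ 0 := by exact_mod_cast (N - i).factorial_ne_zero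
  have h4 : (N.factorial : ℝ) ≠ 0 := by exact_mod_cast N.factorial_ne_zero
  field_simp

theorem P_eq_jacobi (m : ℕ) (θ : ℝ) : P m θ = jacobi m (1 + θ) (1 - θ) :=
  sum_choose_eq_jacobi (by omega) (by ring) (by push_cast; ring)

theorem QSucc_eq_jacobi (m : ℕ) (θ : ℝ) : QSucc m θ = jacobi (m + 1) θ (1 - θ) :=
  sum_choose_eq_jacobi (by omega) (by push_cast; ring) (by push_cast; ring)

theorem R_eq_jacobi (m : ℕ) (θ : ℝ) : R m θ = jacobi m (2 + θ) (1 - θ) :=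
  sum_choose_eq_jacobi (by omega) (by ring) (by push_cast; ring)

/-! ### Orthogonal switch functions -/

theorem AreInterleavedRoots.areRootsInOrder {n : ℕ} {y : Fin n → ℝ} {A B : ℝ[X]}
    (h : AreInterleavedRoots y A B) : AreRootsInOrder y A B := by
  obtain ⟨hy, -, hA, hB⟩ := h
  refine ⟨hy.monotone, ?_⟩
  rw [hA, hB, ← Multiset.map_add]
  exact congrArg _ (Multiset.filter_add_not _ _).symm

/-- The solution with interleaved nodes is the only one, by uniqueness for signed power sums. -/
theorem orthogonal_characterization (m e : ℕ) {n : ℕ} (hn : m + e + m = n) (he : e ≤ 1) {l : ℝ}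
    (hl : l ∈ Set.Ioo (-1 : ℝ) 1) {θ : ℝ} (hθ : θ = (1 - (-1) ^ n * l) / 2) {A B : ℝ[X]}
    (hA : A = jacobi (m + e) (1 - e + θ) (1 - θ)) (hB : B = jacobi m (1 + e - θ) (1 + θ)) :
    (∀ x ∈ simplex n, (Orthogonal x l ↔ AreRootsInOrder x A B) ∧
      (Orthogonal x l → AreInterleavedRoots x A B)) ∧ ∃ x ∈ simplex n, Orthogonal x l := by
  have hpow : (-1 : ℝ) ^ n = (-1) ^ e := by
    rw [← hn, show m + e + m = e + 2 * m by ring, pow_add, pow_mul]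
    norm_num
  have hδ : (e : ℝ) = (1 - (-1) ^ n) / 2 := by
    rw [hpow]
    interval_cases e <;> norm_num
  have h01 : 0 < θ ∧ θ < 1 := by
    obtain ⟨h1, h2⟩ := hl
    rw [hθ]
    rcases neg_one_pow_eq_or ℝ n with h | h <;> rw [h] <;> constructor <;> linarith
  obtain ⟨y, hy, hq⟩ := exists_interleaved_jacobi m e hn he h01.1 h01.2
  rw [← hA, ← hB] at hy
  rw [hδ, hθ] at hq
  have hys : y ∈ simplex n := ⟨hy.1.monotone, fun i => Set.Ioo_subset_Icc_self (hy.2.1 i)⟩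
  have hyo : Orthogonal y l := (orthogonal_iff_signedQuadrature hys l).2 hq
  have huniq : ∀ x ∈ simplex n, Orthogonal x l → x = y := by
    intro x hx ho
    have hxq := (orthogonal_iff_signedQuadrature hx l).1 ho
    refine eq_of_signed_sum_pow_eq hx.1 hy.1 fun j hj => ?_
    have h1 := hxq (X ^ j) (by rwa [natDegree_X_pow])
    have h2 := hq (X ^ j) (by rwa [natDegree_X_pow])
    rw [← h2] at h1
    simpa only [eval_pow, eval_X] using h1
  refine ⟨fun x hx => ⟨⟨fun ho => ?_, fun h => ?_⟩, fun ho => ?_⟩, y, hys, hyo⟩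
  · rw [huniq x hx ho]
    exact hy.areRootsInOrder
  · rwa [eq_of_monotone_of_map_eq hx.1 hy.1.monotone (h.2.trans hy.areRootsInOrder.2.symm)]
  · rwa [huniq x hx ho]

end SwitchFun

theorem mainTheorem2 (l : ℝ) (hl : l ∈ Set.Ioo (-1 : ℝ) 1) :
    (∀ (m : ℕ) (θ : ℝ), θ = (1 - l) / 2 →
      ∀ x ∈ SwitchFun.simplex (2 * m),
        (SwitchFun.Orthogonal x l ↔
          SwitchFun.AreRootsInOrder x (SwitchFun.P m θ) (SwitchFun.P m (-θ))) ∧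
        (SwitchFun.Orthogonal x l →
          SwitchFun.AreInterleavedRoots x (SwitchFun.P m θ) (SwitchFun.P m (-θ)))) ∧
    (∀ (m : ℕ) (θ : ℝ), θ = (1 + l) / 2 →
      ∀ x ∈ SwitchFun.simplex (2 * m + 1),
        (SwitchFun.Orthogonal x l ↔
          SwitchFun.AreRootsInOrder x (SwitchFun.QSucc m θ) (SwitchFun.R m (-θ))) ∧
        (SwitchFun.Orthogonal x l →
          SwitchFun.AreInterleavedRoots x (SwitchFun.QSucc m θ) (SwitchFun.R m (-θ)))) ∧
    (∀ n : ℕ, ∃ x ∈ SwitchFun.simplex n, SwitchFun.Orthogonal x l) := by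
  have heven : ∀ (m : ℕ) (θ : ℝ), θ = (1 - l) / 2 → _ := fun m θ hθ =>
    SwitchFun.orthogonal_characterization m 0 (n := 2 * m) (by ring) (by norm_num) hl (θ := θ)
      (by rw [hθ, pow_mul]; norm_num) (A := SwitchFun.P m θ) (B := SwitchFun.P m (-θ))
      (by rw [SwitchFun.P_eq_jacobi]; norm_num)
      (by rw [SwitchFun.P_eq_jacobi]; norm_num [sub_eq_add_neg])
  have hodd : ∀ (m : ℕ) (θ : ℝ), θ = (1 + l) / 2 → _ := fun m θ hθ =>
    SwitchFun.orthogonal_characterization m 1 (n := 2 * m + 1) (by ring) le_rfl hl (θ := θ)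
      (by rw [hθ, pow_succ, pow_mul]; norm_num) (A := SwitchFun.QSucc m θ) (B := SwitchFun.R m (-θ))
      (by rw [SwitchFun.QSucc_eq_jacobi]; norm_num)
      (by rw [SwitchFun.R_eq_jacobi]; norm_num [sub_eq_add_neg])
  refine ⟨fun m θ hθ => (heven m θ hθ).1, fun m θ hθ => (hodd m θ hθ).1, fun n => ?_⟩
  obtain ⟨m, rfl | rfl⟩ := n.even_or_odd'
  · exact (heven m _ rfl).2
  · exact (hodd m _ rfl).2
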